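/- Let $V$ be a finite set. A \emph{precedence graph} $G=(V,E,c)$ consists of a set $E\subseteq V\times V$ of directed edges and a real weight $c_{ij}$ for every $(i,j)\in E$; it represents the system $x_i-x_j\le c_{ij}$, $(i,j)\in E$, in the unknown $x\in\mathbb R^V$. Two precedence graphs on $V$ are equivalent if their systems have the same solution set. An \emph{equivalent reduction} of $G$ is a precedence graph $G'=(V,E',c')$, with arbitrary edges $E'\subseteq V\times V$ and weights $c'$, that is equivalent to $G$ and has the minimum number of edges among all precedence graphs on $V$ equivalent to $G$. The weight of a walk is the sum of its edge weights (with multiplicity; the one-node walk has weight $0$). Let $G$ be a precedence graph that is feasible, i.e. its system has a solution. Let $d_{ij}$ be the minimum weight of a walk from $i$ to $j$ in $G$. Write $i\sim j$ if $i=j$ or some zero-weight closed walk of $G$ traverses both $i$ and $j$. Let $[v_1],\dots,[v_K]$ be the equivalence classes of $\sim$, with arbitrarily chosen representatives $v_1,\dots,v_K$. For $i\ne j$ let $E_{ij}=E\cap([v_i]\times[v_j])$, and when $E_{ij}\neq\emptyset$ choose an arbitrary edge $(v_{ij}^i,v_{ij}^j)\in E_{ij}$ that minimizes $d_{v_i s}+c_{st}+d_{t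 v_j}$ over $(s,t)\in E_{ij}$. The \emph{condensation} $\tilde G$ has nodes $v_1,\dots,v_K$ and, for $i\neq j$, an edge $(v_i,v_j)$ exactly when $E_{ij}\ne\emptyset$, with weight $\min_{(s,t)\in E_{ij}}\big(d_{v_i s}+c_{st}+d_{t v_j}\big)$. A set $R$ of edges of a weighted directed graph is a \emph{redundant edge set} if for every $(a,b)\in R$ the graph with the edges of $R$ removed contains a simple path from $a$ to $b$ of weight at most that of $(a,b)$. Let $\tilde R_0^\star$ be the redundant edge set of $\tilde G$ of maximum cardinality. \textbf{Theorem.} A precedence graph $G'=(V,E',c')$ is an equivalent reduction of $G$ if and only if all of the following hold. \begin{enumerate} \item For every $k$: if $|[v_k]|=1$, then $E'\cap([v_k]\times[v_k])=\emptyset$; otherwise $E'\cap([v_k]\times[v_k])$ consists of $|[v_k]|$ edges that form a directed cycle of $G'$ of zero weight traversing all nodes of $[v_k]$. \item For all $i\ne j$: if $E_{ij}\neq\emptyset$ and $(v_i,v_j)\notin\tilde R_0^\star$, then $E'\cap([v_i]\times[v_j])$ consists of exactly one edge $(u,v)$ (which may be any pair in $[v_i]\times[v_j]$); if $E_{ij}=\emptyset$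 or $(v_i,v_j)\in\tilde R_0^\star$, then $E'\cap([v_i]\times[v_j])=\emptyset$. \item For every $k$ and every $(u,v)\in E'\cap([v_k]\times[v_k])$: $c'_{uv}=d_{uv}$. \item For all $i\neq j$ and every $(u,v)\in E'\cap([v_i]\times[v_j])$: $c'_{uv}=d_{u v_{ij}^i}+c_{v_{ij}^i v_{ij}^j}+d_{v_{ij}^j v}$. \end{enumerate} -/

import Mathlib

/-- A precedence graph on the node set `V`: a finite set `E ⊆ V × V` of directed edges with a real
weight on each edge. It stands for the system `x i - x j ≤ c i j`, `(i, j) ∈ E`.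
Only the values of `c` on edges carry information: every notion below reads `c i j` only for
`(i, j) ∈ E`. -/
structure PrecGraph (V : Type*) where
  /-- The edge set. -/
  E : Finset (V × V)
  /-- The edge weights. -/
  c : V → V → ℝ

namespace PrecGraph

variable {V : Type*}

/-- `x` is a solution of the precedence relation system of `G`. -/
def Satisfies (G : PrecGraph V) (x : V → ℝ) : Prop :=
  ∀ i j : V, (i, j) ∈ G.E → x i - x j ≤ G.c i j

/-- The system of `G` has at least one solution. -/
def Feasible (G : PrecGraph V) : Prop :=
  ∃ x : V → ℝ, G.Satisfies x

/-- Two precedence graphs on the same nodes are equivalent if they have the same solutions. -/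
def Equivalent (G H : PrecGraph V) : Prop :=
  ∀ x : V → ℝ, G.Satisfies x ↔ H.Satisfies x

/-- `H` is an equivalent reduction of `G`: it is equivalent to `G` and has the least number of
edges among all precedence graphs on `V`, with arbitrary edges and weights, equivalent to `G`. -/
def IsEquivalentReduction (G H : PrecGraph V) : Prop :=
  G.Equivalent H ∧ ∀ H₂ : PrecGraph V, G.Equivalent H₂ → H.E.card ≤ H₂.E.card

/-- Walks from one node to another; `nil u` is the degenerate walk consisting of the node `u`. -/
inductive Walk (G : PrecGraph V) : V → V → Type _
  | nil (u : V) : Walk G u u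
  | cons {u v w : V} (h : (u, v) ∈ G.E) (p : Walk G v w) : Walk G u w

namespace Walk

variable {G : PrecGraph V}

/-- The weight of a walk: the sum of the weights of its edges, with multiplicity. -/
def weight : {u v : V} → G.Walk u v → ℝ
  | _, _, nil _ => 0
  | _, _, cons (u := u) (v := v) _ p => G.c u v + p.weight

/-- The list of traversed nodes, both end points included. -/
def support : {u v : V} → G.Walk u v → List V
  | _, _, nil u => [u]
  | _, _, cons (u := u) _ p => u :: p.support

/-- The list of traversed edges. -/
def edges : {u v : V} → G.Walk u v → List (V × V)
  | _, _, nil _ => []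
  | _, _, cons (u := u) (v := v) _ p => (u, v) :: p.edges

/-- A (simple) path: all traversed nodes are distinct. -/
def IsPath {u v : V} (p : G.Walk u v) : Prop :=
  p.support.Nodup

/-- A cycle: a nondegenerate closed walk whose traversed nodes are distinct, except that the first
one is also the last one. -/
def IsCycle {u : V} (p : G.Walk u u) : Prop :=
  p.edges ≠ [] ∧ p.support.tail.Nodup

end Walk

/-- The relation `i ∼ j`: either `i = j` or some zero-weight closed walk traverses both. -/
def Sim (G : PrecGraph V) (i j : V) : Prop :=
  i = j ∨ ∃ (u : V) (p : G.Walk u u), p.weight = 0 ∧ i ∈ p.support ∧ j ∈ p.support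

/-- The minimum walk weight from `i` to `j`. If `G` is feasible and there is a walk from `i` to `j`,
then the infimum is attained. It is used below only for `i ∼ j`, where there is such a walk. -/
noncomputable def minWalkWeight (G : PrecGraph V) (i j : V) : ℝ :=
  sInf (Set.range fun p : G.Walk i j => p.weight)

open scoped Classical in
/-- The edges that go from the class of `a` to the class of `b`, where the classes are those of an
arbitrary relation `r` on the nodes. -/
noncomputable def edgesBetween (H : PrecGraph V) (r : V → V → Prop) (a b : V) : Finset (V × V) :=
  H.E.filter fun e => r a e.1 ∧ r b e.2

open scoped Classical in
/-- The equivalence class of `a` for `∼`. -/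
noncomputable def cls [Fintype V] (G : PrecGraph V) (a : V) : Finset V :=
  Finset.univ.filter fun u => G.Sim a u

/-- `v 0, …, v (K - 1)` are representing nodes of the equivalence classes of `∼`, one for each
class; hence `K` is the number of classes. -/
def IsRepresentatives (G : PrecGraph V) {K : ℕ} (v : Fin K → V) : Prop :=
  ∀ u : V, ∃! k : Fin K, G.Sim (v k) u

/-- The set `E i j` of the edges of `G` from the class of `v i` to the class of `v j`. -/
noncomputable def interEdges (G : PrecGraph V) {K : ℕ} (v : Fin K → V) (i j : Fin K) :
    Finset (V × V) :=
  G.edgesBetween G.Sim (v i) (v j)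

/-- The weight `d (v i) s + c s t + d t (v j)` of an edge `(s, t)` of `E i j`, seen from the
representing nodes. -/
noncomputable def detour (G : PrecGraph V) {K : ℕ} (v : Fin K → V) (i j : Fin K) (e : V × V) : ℝ :=
  G.minWalkWeight (v i) e.1 + G.c e.1 e.2 + G.minWalkWeight e.2 (v j)

/-- `r i j` is a representing edge of `E i j`, for all `i ≠ j` with `E i j` nonempty: it is one of
the edges of `E i j` at which `d (v i) s + c s t + d t (v j)` is least. -/
def IsRepresentingEdges (G : PrecGraph V) {K : ℕ} (v : Fin K → V)
    (r : Fin K → Fin K → V × V) : Prop :=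
  ∀ i j : Fin K, i ≠ j → (G.interEdges v i j).Nonempty →
    r i j ∈ G.interEdges v i j ∧
      ∀ e ∈ G.interEdges v i j, G.detour v i j (r i j) ≤ G.detour v i j e

open scoped Classical in
/-- The condensation of `G`. Its nodes are the representing nodes, with `v i` written as the
index `i`; there is an edge from `i` to `j ≠ i` if and only if `E i j` is nonempty, and its weight
is the minimum of `d (v i) s + c s t + d t (v j)` over `(s, t) ∈ E i j`. -/
noncomputable def condensation (G : PrecGraph V) {K : ℕ} (v : Fin K → V) : PrecGraph (Fin K) where
  E := Finset.univ.filter fun p => p.1 ≠ p.2 ∧ (G.interEdges v p.1 p.2).Nonempty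
  c i j := sInf (G.detour v i j '' (G.interEdges v i j : Set (V × V)))

open scoped Classical in
/-- The graph with the edges of `R` removed. -/
noncomputable def deleteEdges (G : PrecGraph V) (R : Finset (V × V)) : PrecGraph V where
  E := G.E \ R
  c := G.c

/-- `R` is a redundant edge set of `G`: for every `(a, b) ∈ R`, some path from `a` to `b` without
edges of `R` has weight at most `c a b`. -/
def IsRedundantEdgeSet (G : PrecGraph V) (R : Finset (V × V)) : Prop :=
  R ⊆ G.E ∧ ∀ a b : V, (a, b) ∈ R →
    ∃ p : (G.deleteEdges R).Walk a b, p.IsPath ∧ p.weight ≤ G.c a b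

/-- `R` is a redundant edge set of `G` of maximum cardinality. -/
def IsMaximumRedundantEdgeSet (G : PrecGraph V) (R : Finset (V × V)) : Prop :=
  G.IsRedundantEdgeSet R ∧ ∀ R₂ : Finset (V × V), G.IsRedundantEdgeSet R₂ → R₂.card ≤ R.card

/-- The edges in `F` are exactly the edges of a zero-weight directed cycle of `H` that traverses
all nodes of `S` and no others. -/
def FormsZeroWeightCycle (H : PrecGraph V) (F : Finset (V × V)) (S : Finset V) : Prop :=
  ∃ (u : V) (p : H.Walk u u), p.IsCycle ∧ p.weight = 0 ∧
    (∀ w : V, w ∈ p.support ↔ w ∈ S) ∧ (∀ e : V × V, e ∈ p.edges ↔ e ∈ F)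

end PrecGraph

/-! By duality, a feasible system implies `x s - x t ≤ w` exactly when some walk from `s` to `t` has
weight at most `w` (`Satisfies.reaches`). So minimum walk weights, the relation `∼`, and every
notion built from them depend only on the solution set and agree in all graphs equivalent to `G`.
One such notion is that of an essential pair of classes: the second is reachable from the first, and
no minimum weight walk between them meets a third class (`IsEssential`).

Every equivalent graph needs, at each node of a class with several nodes, an edge leading to another
node of the class, and one edge for each essential pair (`Equivalent.blockCard_le`). Conversely,
tight connections inside classes and one tight edge per essential pair generate all distances,
because an inessential pair splits at a third class (`reaches_induction`, `equivalent_of_tight`).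
One cycle per class attains all the lower bounds at once, so an equivalent reduction is an
equivalent graph that attains each of them (`isEquivalentReduction_iff_card`). Equality inside a
class forces exactly one outgoing edge per node, hence a cycle (`Equivalent.formsZeroWeightCycle`).

The condensation enters through one fact: its redundant edge sets all lie in the set of inessential
edges, which is itself redundant and hence the unique maximum
(`IsMaximumRedundantEdgeSet.eq_inessentialEdges`). -/

namespace PrecGraph

variable {V : Type*} {G H : PrecGraph V} {x : V → ℝ} {s t : V} {w : ℝ}

/-! ### Walks: splitting, shortening to paths, weights. -/

namespace Walk

/-- Concatenation of walks. -/
def append : {a b d : V} → G.Walk a b → G.Walk b d → G.Walk a d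
  | _, _, _, nil _, q => q
  | _, _, _, cons h p, q => cons h (p.append q)

theorem weight_append {a b d : V} (p : G.Walk a b) (q : G.Walk b d) :
    (p.append q).weight = p.weight + q.weight := by
  induction p with
  | nil u => simp [append, weight]
  | cons h p ih => simp [append, weight, ih, add_assoc]

theorem start_mem_support {a b : V} (p : G.Walk a b) : a ∈ p.support := by
  cases p <;> simp [support]

theorem end_mem_support {a b : V} (p : G.Walk a b) : b ∈ p.support := by
  induction p with
  | nil u => simp [support]
  | cons h p ih => simp [support, ih]

theorem mem_support_append {a b d z : V} (p : G.Walk a b) (q : G.Walk b d) :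
    z ∈ (p.append q).support ↔ z ∈ p.support ∨ z ∈ q.support := by
  induction p with
  | nil u =>
    simp only [append, support, List.mem_singleton]
    exact ⟨Or.inr, fun h => h.elim (fun h => h ▸ q.start_mem_support) id⟩
  | cons h p ih => simp [append, support, ih, or_assoc]

/-- A walk can be split at each of its nodes. -/
theorem exists_split {a b u : V} (p : G.Walk a b) (hu : u ∈ p.support) :
    ∃ (q : G.Walk a u) (r : G.Walk u b), q.weight + r.weight = p.weight ∧
      r.support <:+ p.support ∧ ∀ z ∈ p.support, z ∈ q.support ∨ z ∈ r.support := by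
  induction p with
  | nil y =>
    obtain rfl : u = y := by simpa [support] using hu
    exact ⟨nil u, nil u, by simp [weight], List.suffix_rfl, fun z hz => Or.inl hz⟩
  | @cons y z b h p ih =>
    by_cases huy : u = y
    · subst huy
      exact ⟨nil u, cons h p, by simp [weight], List.suffix_rfl, fun z hz => Or.inr hz⟩
    · have hu' : u ∈ p.support := by simpa [support, huy] using hu
      obtain ⟨q, r, h₁, h₂, h₃⟩ := ih hu'
      refine ⟨cons h q, r, by simp [weight, ← h₁, add_assoc],
        h₂.trans (List.suffix_cons _ _), fun m hm => ?_⟩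
      simp only [support, List.mem_cons] at hm ⊢
      rcases hm with rfl | hm
      · exact Or.inl (Or.inl rfl)
      · exact (h₃ m hm).imp Or.inr id

theorem sub_le_weight (hx : G.Satisfies x) {a b : V} (p : G.Walk a b) : x a - x b ≤ p.weight := by
  induction p with
  | nil u => simp [weight]
  | cons h p ih =>
    have := hx _ _ h
    simp only [weight]
    linarith

/-- In a feasible graph each walk can be shortened to a path without increasing the weight. -/
theorem exists_isPath (hx : G.Satisfies x) {a b : V} (p : G.Walk a b) :
    ∃ q : G.Walk a b, q.IsPath ∧ q.weight ≤ p.weight := by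
  induction p with
  | nil u => exact ⟨nil u, by simp [IsPath, support], le_rfl⟩
  | @cons y z b h p ih =>
    obtain ⟨q, hq, hw⟩ := ih
    by_cases hy : y ∈ q.support
    · obtain ⟨q₁, q₂, h₁, h₂, -⟩ := q.exists_split hy
      refine ⟨q₂, hq.sublist h₂.sublist, ?_⟩
      -- The discarded part, the new edge followed by `q₁`, is a closed walk, so its weight is
      -- nonnegative by feasibility.
      have h₃ := q₁.sub_le_weight hx
      have h₄ := hx _ _ h
      simp only [weight]
      linarith
    · exact ⟨cons h q, by simpa [IsPath, support] using ⟨hy, hq⟩, by simpa [weight] using hw⟩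

theorem mem_edges {a b : V} (p : G.Walk a b) {e : V × V} (he : e ∈ p.edges) :
    e ∈ G.E ∧ e.1 ∈ p.support ∧ e.2 ∈ p.support := by
  induction p with
  | nil u => simp [edges] at he
  | cons h p ih =>
    simp only [edges, List.mem_cons] at he
    rcases he with rfl | he
    · exact ⟨h, by simp [support], by simp [support, p.start_mem_support]⟩
    · obtain ⟨h₁, h₂, h₃⟩ := ih he
      exact ⟨h₁, by simp [support, h₂], by simp [support, h₃]⟩

theorem exists_edge_of_mem_support {a b z : V} (p : G.Walk a b) (hz : z ∈ p.support) :
    z = b ∨ ∃ y, (z, y) ∈ p.edges := by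
  induction p with
  | nil u => exact Or.inl (by simpa [support] using hz)
  | cons h p ih =>
    simp only [support, List.mem_cons] at hz
    rcases hz with rfl | hz
    · exact Or.inr ⟨_, by simp only [edges, List.mem_cons]; exact Or.inl rfl⟩
    · exact (ih hz).imp id fun ⟨y, hy⟩ => ⟨y, by simp [edges, hy]⟩

/-- The sum of the weights along a list of nodes. -/
def chainWeight (c : V → V → ℝ) : List V → ℝ
  | [] => 0
  | [_] => 0
  | a :: b :: l => c a b + chainWeight c (b :: l)

theorem weight_eq_chainWeight {a b : V} (p : G.Walk a b) :
    p.weight = chainWeight G.c p.support := by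
  induction p with
  | nil u => simp [weight, support, chainWeight]
  | cons h p ih =>
    simp only [weight, support, ih]
    cases p <;> simp [support, chainWeight]

/-- The weight depends only on the list of nodes, and there are finitely many lists without
repetition. This is why minimum walk weights are attained. -/
theorem finite_weight_isPath [Finite V] (G : PrecGraph V) (a b : V) :
    {y : ℝ | ∃ p : G.Walk a b, p.IsPath ∧ p.weight = y}.Finite := by
  have := Fintype.ofFinite V
  classical
  have h : {l : List V | l.Nodup}.Finite :=
    Set.finite_coe_iff.1 (inferInstanceAs (Finite {l : List V // l.Nodup}))
  refine (h.image (chainWeight G.c)).subset ?_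
  rintro _ ⟨p, hp, rfl⟩
  exact ⟨p.support, hp, p.weight_eq_chainWeight.symm⟩

end Walk

/-! ### Walk bounds, duality and invariance under equivalence. -/

/-- Some walk from `s` to `t` has weight at most `w`. -/
def Reaches (G : PrecGraph V) (s t : V) (w : ℝ) : Prop :=
  ∃ p : G.Walk s t, p.weight ≤ w

namespace Reaches

theorem refl (G : PrecGraph V) (s : V) (hw : 0 ≤ w) : G.Reaches s s w :=
  ⟨.nil s, hw⟩

theorem of_edge (h : (s, t) ∈ G.E) : G.Reaches s t (G.c s t) :=
  ⟨.cons h (.nil t), by simp [Walk.weight]⟩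

theorem mono {w' : ℝ} (h : G.Reaches s t w) (hw : w ≤ w') : G.Reaches s t w' :=
  h.imp fun _ hp => hp.trans hw

theorem trans {a b d : V} {w₁ w₂ : ℝ} (h₁ : G.Reaches a b w₁) (h₂ : G.Reaches b d w₂) :
    G.Reaches a d (w₁ + w₂) := by
  obtain ⟨p, hp⟩ := h₁
  obtain ⟨q, hq⟩ := h₂
  exact ⟨p.append q, by rw [Walk.weight_append]; exact add_le_add hp hq⟩

/-- A map of nodes along which edges are dominated by walks preserves `Reaches`. -/
theorem map {W : Type*} {F : PrecGraph W} (f : W → V)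
    (hf : ∀ i j, (i, j) ∈ F.E → G.Reaches (f i) (f j) (F.c i j)) {i j : W}
    (h : F.Reaches i j w) : G.Reaches (f i) (f j) w := by
  obtain ⟨p, hp⟩ := h
  refine mono ?_ hp
  clear hp
  induction p with
  | nil u => exact refl _ _ le_rfl
  | cons h p ih => exact (hf _ _ h).trans ih

theorem sub_le (hx : G.Satisfies x) (h : G.Reaches s t w) : x s - x t ≤ w := by
  obtain ⟨p, hp⟩ := h
  exact (p.sub_le_weight hx).trans hp

theorem minWalkWeight_le (hx : G.Satisfies x) (h : G.Reaches s t w) :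
    G.minWalkWeight s t ≤ w := by
  obtain ⟨p, hp⟩ := h
  have hb : BddBelow (Set.range fun q : G.Walk s t => q.weight) := by
    refine ⟨x s - x t, ?_⟩
    rintro _ ⟨q, rfl⟩
    exact q.sub_le_weight hx
  exact (csInf_le hb ⟨p, rfl⟩).trans hp

/-- The minimum walk weight is attained. -/
theorem minWalkWeight [Finite V] (hx : G.Satisfies x) (h : G.Reaches s t w) :
    G.Reaches s t (G.minWalkWeight s t) := by
  obtain ⟨p, -⟩ := h
  obtain ⟨q, hq, -⟩ := p.exists_isPath hx
  obtain ⟨y, ⟨m, hm, rfl⟩, hmin⟩ :=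
    Set.exists_min_image _ id (Walk.finite_weight_isPath G s t) ⟨_, q, hq, rfl⟩
  refine ⟨m, le_csInf ⟨_, m, rfl⟩ ?_⟩
  rintro _ ⟨z, rfl⟩
  obtain ⟨z', hz', hle⟩ := z.exists_isPath hx
  exact (hmin _ ⟨z', hz', rfl⟩).trans hle

end Reaches

/-- Every inequality implied by a feasible system is witnessed by a walk. -/
theorem Satisfies.reaches [Finite V] (hx : G.Satisfies x)
    (h : ∀ y : V → ℝ, G.Satisfies y → y s - y t ≤ w) : G.Reaches s t w := by
  classical
  -- The solution `y` is the distance to `t`, capped by the shifted solution `x + M` so that it is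
  -- defined at nodes from which `t` is unreachable. The constant makes the cap equal to `w + 1` at
  -- `s`; since `y t ≤ 0` and `y s - y t ≤ w`, the cap cannot be active at `s`.
  let M : ℝ := w - x s + 1
  let y : V → ℝ := fun u =>
    if ∃ z, G.Reaches u t z then min (G.minWalkWeight u t) (x u + M) else x u + M
  have hy_le : ∀ u, y u ≤ x u + M := fun u => by
    by_cases hu : ∃ z, G.Reaches u t z
    · simp only [y, if_pos hu]
      exact min_le_right _ _
    · simp only [y, if_neg hu, le_refl]
  have hy : G.Satisfies y := by
    intro a b hab
    have h₁ := hx a b hab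
    by_cases hb : ∃ z, G.Reaches b t z
    · obtain ⟨z, hz⟩ := hb
      have ha' := (Reaches.of_edge hab).trans (hz.minWalkWeight hx)
      have h₂ := ha'.minWalkWeight_le hx
      have h₃ := hy_le a
      simp only [y, if_pos (⟨z, hz⟩ : ∃ z, G.Reaches b t z)]
      rw [sub_le_iff_le_add, ← min_add_add_left, le_min_iff]
      refine ⟨?_, by linarith⟩
      refine le_trans ?_ h₂
      simp only [if_pos (⟨_, ha'⟩ : ∃ z, G.Reaches a t z)]
      exact min_le_left _ _
    · have h₂ := hy_le a
      simp only [y, if_neg hb] at h₂ ⊢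
      linarith
  have hyt : y t ≤ 0 := by
    have ht : G.Reaches t t 0 := .refl _ _ le_rfl
    simp only [y, if_pos (⟨0, ht⟩ : ∃ z, G.Reaches t t z)]
    exact (min_le_left _ _).trans (ht.minWalkWeight_le hx)
  have hys := h y hy
  by_cases hs : ∃ z, G.Reaches s t z
  · have h₁ : y s ≤ w := by linarith
    simp only [y, if_pos hs, min_le_iff] at h₁
    obtain ⟨z, hz⟩ := hs
    rcases h₁ with h₁ | h₁
    · exact (hz.minWalkWeight hx).mono h₁
    · simp only [M] at h₁
      linarith
  · simp only [y, if_neg hs, M] at hys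
    linarith

/-- Both sides express that the common system implies `y s - y t ≤ w`. All later invariance
statements rest on this. -/
theorem Equivalent.reaches_iff [Finite V] (hx : G.Satisfies x) (h : G.Equivalent H) :
    H.Reaches s t w ↔ G.Reaches s t w :=
  ⟨fun hr => hx.reaches fun y hy => hr.sub_le ((h y).1 hy),
    fun hr => ((h x).1 hx).reaches fun y hy => hr.sub_le ((h y).2 hy)⟩

theorem Equivalent.minWalkWeight_eq [Finite V] (hx : G.Satisfies x) (h : G.Equivalent H) :
    H.minWalkWeight s t = G.minWalkWeight s t := by
  by_cases hr : ∃ z, G.Reaches s t z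
  · obtain ⟨z, hz⟩ := hr
    have hz' := (h.reaches_iff hx).2 hz
    have hx' := (h x).1 hx
    exact le_antisymm (((h.reaches_iff hx).2 (hz.minWalkWeight hx)).minWalkWeight_le hx')
      (((h.reaches_iff hx).1 (hz'.minWalkWeight hx')).minWalkWeight_le hx)
  · have hG : IsEmpty (G.Walk s t) := ⟨fun p => hr ⟨_, p, le_rfl⟩⟩
    have hH : IsEmpty (H.Walk s t) := ⟨fun p => hr ⟨_, (h.reaches_iff hx).1 ⟨p, le_rfl⟩⟩⟩
    -- Without walks both sides are the infimum of the empty set.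
    simp [PrecGraph.minWalkWeight, Set.range_eq_empty]

theorem equivalent_of_reaches
    (h₁ : ∀ a b, (a, b) ∈ H.E → G.Reaches a b (H.c a b))
    (h₂ : ∀ a b, (a, b) ∈ G.E → H.Reaches a b (G.c a b)) : G.Equivalent H :=
  fun _ => ⟨fun hx a b hab => (h₁ a b hab).sub_le hx, fun hx a b hab => (h₂ a b hab).sub_le hx⟩

/-! ### Equivalent nodes and tight walks. -/

/-- Equivalent nodes are joined in both directions by walks whose weights are the differences of
any solution. -/
theorem sim_iff (hx : G.Satisfies x) :
    G.Sim s t ↔ G.Reaches s t (x s - x t) ∧ G.Reaches t s (x t - x s) := by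
  constructor
  · rintro (rfl | ⟨u, p, hp, hs, ht⟩)
    · exact ⟨.refl _ _ (by simp), .refl _ _ (by simp)⟩
    · obtain ⟨p₁, p₂, h₁, -, h₂⟩ := p.exists_split hs
      -- Rotating the closed walk to start at `s` and cutting it at `t` gives two arcs of total
      -- weight zero. Their lower bounds `x s - x t` and `x t - x s` also add up to zero, so both
      -- are attained.
      have ht' : t ∈ (p₂.append p₁).support := (Walk.mem_support_append _ _).2 (h₂ t ht).symm
      obtain ⟨q₁, q₂, h₃, -, -⟩ := (p₂.append p₁).exists_split ht'
      rw [Walk.weight_append] at h₃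
      have h₄ := q₁.sub_le_weight hx
      have h₅ := q₂.sub_le_weight hx
      exact ⟨⟨q₁, by linarith⟩, ⟨q₂, by linarith⟩⟩
  · rintro ⟨⟨p, hp⟩, ⟨q, hq⟩⟩
    refine Or.inr ⟨s, p.append q, ?_, Walk.start_mem_support _,
      (Walk.mem_support_append _ _).2 (Or.inl p.end_mem_support)⟩
    have := (p.append q).sub_le_weight hx
    rw [Walk.weight_append] at this ⊢
    linarith

namespace Sim

theorem refl (G : PrecGraph V) (s : V) : G.Sim s s := Or.inl rfl

theorem symm (h : G.Sim s t) : G.Sim t s :=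
  h.imp Eq.symm fun ⟨u, p, hp, hs, ht⟩ => ⟨u, p, hp, ht, hs⟩

theorem reaches (h : G.Sim s t) (hx : G.Satisfies x) : G.Reaches s t (x s - x t) :=
  ((sim_iff hx).1 h).1

theorem trans {a b d : V} (h₁ : G.Sim a b) (h₂ : G.Sim b d) (hx : G.Satisfies x) : G.Sim a d :=
  (sim_iff hx).2 ⟨((h₁.reaches hx).trans (h₂.reaches hx)).mono (by linarith),
    ((h₂.symm.reaches hx).trans (h₁.symm.reaches hx)).mono (by linarith)⟩

/-- Inside a class distances are potential differences of any solution, which turns later distance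
identities into linear arithmetic. -/
theorem minWalkWeight_eq [Finite V] (h : G.Sim s t) (hx : G.Satisfies x) :
    G.minWalkWeight s t = x s - x t :=
  le_antisymm ((h.reaches hx).minWalkWeight_le hx)
    (((h.reaches hx).minWalkWeight hx).sub_le hx)

end Sim

theorem sim_of_reaches {w₁ w₂ : ℝ} (hx : G.Satisfies x) (h₁ : G.Reaches s t w₁)
    (h₂ : G.Reaches t s w₂) (h : w₁ + w₂ ≤ 0) : G.Sim s t := by
  have h₃ := h₁.sub_le hx
  have h₄ := h₂.sub_le hx
  exact (sim_iff hx).2 ⟨h₁.mono (by linarith), h₂.mono (by linarith)⟩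

theorem Reaches.congr {s' t' : V} (hx : G.Satisfies x) (h : G.Reaches s t w) (hs : G.Sim s s')
    (ht : G.Sim t t') : G.Reaches s' t' (x s' - x s + w + x t - x t') :=
  ((hs.symm.reaches hx).trans (h.trans (ht.reaches hx))).mono (by linarith)

theorem minWalkWeight_congr [Finite V] {s' t' : V} (hx : G.Satisfies x) (h : G.Reaches s t w)
    (hs : G.Sim s s') (ht : G.Sim t t') :
    G.minWalkWeight s' t' = x s' - x s + G.minWalkWeight s t + x t - x t' := by
  have h₁ := (h.minWalkWeight hx).congr hx hs ht
  have h₂ := ((h₁.minWalkWeight hx).congr hx hs.symm ht.symm).minWalkWeight_le hx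
  have h₃ := h₁.minWalkWeight_le hx
  linarith

theorem Equivalent.sim_iff [Finite V] (hx : G.Satisfies x) (h : G.Equivalent H) :
    H.Sim s t ↔ G.Sim s t := by
  rw [PrecGraph.sim_iff hx, PrecGraph.sim_iff ((h x).1 hx), h.reaches_iff hx, h.reaches_iff hx]

/-- All nodes of a tight walk between equivalent nodes are equivalent. -/
theorem sim_of_mem_support (hx : G.Satisfies x) (h : G.Sim s t) (p : G.Walk s t)
    (hp : p.weight ≤ x s - x t) {z : V} (hz : z ∈ p.support) : G.Sim s z := by
  obtain ⟨q, r, hw, -, -⟩ := p.exists_split hz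
  have hr : G.Reaches z t r.weight := ⟨r, le_rfl⟩
  exact sim_of_reaches hx ⟨q, le_rfl⟩ (hr.trans (h.symm.reaches hx)) (by linarith)

/-- A node that is not alone in its class has a tight edge to another node of the class. -/
theorem exists_tight_edge (hx : G.Satisfies x) (h : G.Sim s t) (hne : s ≠ t) :
    ∃ b, (s, b) ∈ G.E ∧ b ≠ s ∧ G.Sim s b ∧ G.c s b = x s - x b := by
  obtain ⟨p, hp⟩ := h.reaches hx
  obtain ⟨q, hq, hle⟩ := p.exists_isPath hx
  cases q with
  | nil => exact absurd rfl hne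
  | @cons _ b _ hb q =>
    simp only [Walk.weight] at hle
    have h₁ := hx _ _ hb
    have h₂ := q.sub_le_weight hx
    refine ⟨b, hb, ?_, ?_, by linarith⟩
    · rintro rfl
      simp only [Walk.IsPath, Walk.support, List.nodup_cons] at hq
      exact hq.1 q.start_mem_support
    · exact sim_of_mem_support hx h (.cons hb q) (by simp only [Walk.weight]; linarith)
        (by simp [Walk.support, q.start_mem_support])

/-! ### Essential pairs of classes. -/

/-- The class of `t` is reachable from the different class of `s`, and no minimum weight walk from
`s` to `t` meets a third class. -/
def IsEssential (G : PrecGraph V) (s t : V) : Prop :=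
  ¬ G.Sim s t ∧ (∃ w, G.Reaches s t w) ∧ ∀ (k : V) (a b : ℝ), G.Reaches s k a → G.Reaches k t b →
    a + b ≤ G.minWalkWeight s t → G.Sim s k ∨ G.Sim k t

theorem Equivalent.isEssential_iff [Finite V] (hx : G.Satisfies x) (h : G.Equivalent H) :
    H.IsEssential s t ↔ G.IsEssential s t := by
  simp only [IsEssential, h.sim_iff hx, h.reaches_iff hx, h.minWalkWeight_eq hx]

namespace IsEssential

theorem congr [Finite V] {s' t' : V} (hx : G.Satisfies x) (h : G.IsEssential s t)
    (hs : G.Sim s s') (ht : G.Sim t t') : G.IsEssential s' t' := by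
  obtain ⟨h₁, ⟨w, hw⟩, h₂⟩ := h
  refine ⟨fun hc => h₁ ((hs.trans hc hx).trans ht.symm hx), ⟨_, hw.congr hx hs ht⟩,
    fun k a b ha hb hab => ?_⟩
  rw [minWalkWeight_congr hx hw hs ht] at hab
  have ha' := ha.congr hx hs.symm (.refl G k)
  have hb' := hb.congr hx (.refl G k) ht.symm
  refine (h₂ k _ _ ha' hb' (by linarith)).imp (fun h => hs.symm.trans h hx)
    fun h => h.trans ht hx

theorem reaches [Finite V] (hx : G.Satisfies x) (h : G.IsEssential s t) :
    G.Reaches s t (G.minWalkWeight s t) :=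
  h.2.1.elim fun _ hw => hw.minWalkWeight hx

/-- There is a tight edge from the class of `s` to the class of `t`. -/
theorem exists_edge [Finite V] (hx : G.Satisfies x) (h : G.IsEssential s t) :
    ∃ a b, (a, b) ∈ G.E ∧ G.Sim s a ∧ G.Sim t b ∧
      G.c a b ≤ x a - x s + G.minWalkWeight s t + x t - x b := by
  obtain ⟨p, hp⟩ := h.reaches hx
  -- The start of the walk is generalized within the class of `s`, so that the induction can advance
  -- to the first edge leaving this class.
  suffices H : ∀ (a b : V) (p : G.Walk a b), G.Sim s a → b = t →
      p.weight ≤ x a - x s + G.minWalkWeight s t → ∃ a b, (a, b) ∈ G.E ∧ G.Sim s a ∧ G.Sim t b ∧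
        G.c a b ≤ x a - x s + G.minWalkWeight s t + x t - x b from
    H s t p (.refl G s) rfl (by linarith)
  intro a b q
  induction q with
  | nil u => rintro hu rfl; exact absurd hu h.1
  | @cons a b d hab q ih =>
    rintro ha rfl hw
    simp only [Walk.weight] at hw
    have h₁ := hx _ _ hab
    have h₂ := q.sub_le_weight hx
    by_cases hb : G.Sim s b
    · exact ih hb rfl (by linarith)
    -- The first node outside the class of `s` lies on a minimum weight walk, so essentiality puts
    -- it in the class of `t`.
    · rcases h.2.2 b _ _ ((ha.reaches hx).trans (.of_edge hab)) ⟨q, le_rfl⟩ (by linarith)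
        with h₃ | h₃
      · exact absurd h₃ hb
      · exact ⟨a, b, hab, ha, h₃.symm, by linarith⟩

end IsEssential

/-- To prove a property of all pairs of nodes joined by a walk, it suffices to prove it for
equivalent and essential pairs, and to show that it can be composed along minimum weight walks. -/
theorem reaches_induction [Finite V] (hx : G.Satisfies x) {Q : V → V → Prop}
    (sim : ∀ s t, G.Sim s t → Q s t) (ess : ∀ s t, G.IsEssential s t → Q s t)
    (trans : ∀ s k t, G.Reaches s k (G.minWalkWeight s k) → G.Reaches k t (G.minWalkWeight k t) →
      G.minWalkWeight s k + G.minWalkWeight k t = G.minWalkWeight s t →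
      Q s k → Q k t → Q s t)
    {s t : V} {w : ℝ} (h : G.Reaches s t w) : Q s t := by
  -- The induction is on the number of nodes lying on minimum weight walks. Splitting at a node `k`
  -- of a third class removes `t` from this set for the pair `(s, k)`, and `s` for the pair `(k,
  -- t)`; otherwise a closed walk of weight at most zero would put `k` in the class of `t` or of
  -- `s`.
  let I : V → V → Set V := fun s t =>
    {k | ∃ a b, G.Reaches s k a ∧ G.Reaches k t b ∧ a + b ≤ G.minWalkWeight s t}
  suffices H : ∀ (n : ℕ) (s t : V), (I s t).ncard = n → (∃ w, G.Reaches s t w) → Q s t from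
    H _ s t rfl ⟨w, h⟩
  intro n
  induction n using Nat.strong_induction_on with
  | _ n ih =>
    rintro s t rfl ⟨w, hw⟩
    by_cases h₁ : G.Sim s t
    · exact sim s t h₁
    by_cases h₂ : G.IsEssential s t
    · exact ess s t h₂
    have h₃ : ∃ (k : V) (a b : ℝ), G.Reaches s k a ∧ G.Reaches k t b ∧
        a + b ≤ G.minWalkWeight s t ∧ ¬ G.Sim s k ∧ ¬ G.Sim k t := by
      by_contra hc
      refine h₂ ⟨h₁, ⟨w, hw⟩, fun k a b ha hb hab => ?_⟩
      by_contra hk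
      exact hc ⟨k, a, b, ha, hb, hab, not_or.1 hk⟩
    obtain ⟨k, a, b, ha, hb, hab, hsk, hkt⟩ := h₃
    have ha₁ := ha.minWalkWeight hx
    have hb₁ := hb.minWalkWeight hx
    have ha₂ := ha.minWalkWeight_le hx
    have hb₂ := hb.minWalkWeight_le hx
    have hst := hw.minWalkWeight hx
    have htri := (ha₁.trans hb₁).minWalkWeight_le hx
    refine trans s k t ha₁ hb₁ (by linarith) (ih _ ?_ s k rfl ⟨a, ha⟩) (ih _ ?_ k t rfl ⟨b, hb⟩)
    · refine Set.ncard_lt_ncard ⟨?_, fun hsub => ?_⟩ (Set.toFinite _)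
      · rintro m ⟨a', b', h₄, h₅, h₆⟩
        exact ⟨a', _, h₄, h₅.trans hb₁, by linarith⟩
      · have ht : t ∈ I s t := ⟨_, 0, hst, .refl _ _ le_rfl, by linarith⟩
        obtain ⟨a', b', h₄, h₅, h₆⟩ := hsub ht
        have h₇ := h₄.minWalkWeight_le hx
        exact hkt (sim_of_reaches hx hb₁ h₅ (by linarith))
    · refine Set.ncard_lt_ncard ⟨?_, fun hsub => ?_⟩ (Set.toFinite _)
      · rintro m ⟨a', b', h₄, h₅, h₆⟩
        exact ⟨_, b', ha₁.trans h₄, h₅, by linarith⟩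
      · have hs : s ∈ I s t := ⟨0, _, .refl _ _ le_rfl, hst, by linarith⟩
        obtain ⟨a', b', h₄, h₅, h₆⟩ := hsub hs
        have h₇ := h₅.minWalkWeight_le hx
        exact hsk (sim_of_reaches hx ha₁ h₄ (by linarith))

/-- A graph whose edges are implied by `G`, in which equivalent nodes are joined by tight walks and
essential pairs of classes by tight edges, is equivalent to `G`. -/
theorem equivalent_of_tight [Finite V] (hx : G.Satisfies x)
    (sound : ∀ a b, (a, b) ∈ H.E → G.Reaches a b (H.c a b))
    (sim : ∀ s t, G.Sim s t → H.Reaches s t (x s - x t))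
    (ess : ∀ s t, G.IsEssential s t → ∃ a b, (a, b) ∈ H.E ∧ G.Sim s a ∧ G.Sim t b ∧
      H.c a b ≤ x a - x s + G.minWalkWeight s t + x t - x b) : G.Equivalent H := by
  refine equivalent_of_reaches sound fun a b hab => ?_
  have key : H.Reaches a b (G.minWalkWeight a b) := by
    refine reaches_induction hx (Q := fun s t => H.Reaches s t (G.minWalkWeight s t)) ?_ ?_ ?_
      (Reaches.of_edge hab)
    · intro s t h
      rw [h.minWalkWeight_eq hx]
      exact sim s t h
    · intro s t h
      obtain ⟨a, b, hab, ha, hb, hc⟩ := ess s t h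
      exact ((sim s a ha).trans ((Reaches.of_edge hab).trans (sim b t hb.symm))).mono (by linarith)
    · intro s k t _ _ h h₁ h₂
      exact h ▸ h₁.trans h₂
  exact key.mono ((Reaches.of_edge hab).minWalkWeight_le hx)

theorem mem_edgesBetween {ρ : V → V → Prop} {a b : V} {e : V × V} :
    e ∈ H.edgesBetween ρ a b ↔ e ∈ H.E ∧ ρ a e.1 ∧ ρ b e.2 := by
  simp [edgesBetween]

theorem mem_cls [Fintype V] {a u : V} : u ∈ G.cls a ↔ G.Sim a u := by
  simp [cls]

theorem mem_cls_self [Fintype V] (a : V) : a ∈ G.cls a :=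
  mem_cls.2 (.refl G a)

theorem eq_of_sim_of_card_cls_eq_one [Fintype V] {a u u' : V} (h : (G.cls a).card = 1)
    (hu : G.Sim a u) (hu' : G.Sim a u') : u = u' := by
  obtain ⟨z, hz⟩ := Finset.card_eq_one.1 h
  have h₁ : u ∈ G.cls a := mem_cls.2 hu
  have h₂ : u' ∈ G.cls a := mem_cls.2 hu'
  rw [hz, Finset.mem_singleton] at h₁ h₂
  rw [h₁, h₂]

theorem exists_sim_ne_of_card_cls_ne_one [Fintype V] {a : V} (h : (G.cls a).card ≠ 1) (u : V) :
    ∃ u', G.Sim a u' ∧ u' ≠ u := by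
  have h₁ : 0 < (G.cls a).card := Finset.card_pos.2 ⟨a, mem_cls_self a⟩
  obtain ⟨u', hu', hne⟩ := Finset.exists_mem_ne (show 1 < (G.cls a).card by omega) u
  exact ⟨u', mem_cls.1 hu', hne⟩

/-! ### The condensation and its maximum redundant edge set. -/

section Condensation

variable {K : ℕ} {v : Fin K → V} {r : Fin K → Fin K → V × V} {i j : Fin K}

theorem IsRepresentatives.eq_of_sim (hv : G.IsRepresentatives v) {u : V} (hi : G.Sim (v i) u)
    (hj : G.Sim (v j) u) : i = j :=
  (hv u).unique hi hj

theorem IsRepresentatives.not_sim (hv : G.IsRepresentatives v) (h : i ≠ j) :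
    ¬ G.Sim (v i) (v j) :=
  fun hs => h (hv.eq_of_sim hs (.refl G _))

theorem mem_interEdges {e : V × V} :
    e ∈ G.interEdges v i j ↔ e ∈ G.E ∧ G.Sim (v i) e.1 ∧ G.Sim (v j) e.2 :=
  mem_edgesBetween

theorem detour_eq [Finite V] (hx : G.Satisfies x) {e : V × V} (h₁ : G.Sim (v i) e.1)
    (h₂ : G.Sim (v j) e.2) :
    G.detour v i j e = x (v i) - x e.1 + G.c e.1 e.2 + (x e.2 - x (v j)) := by
  rw [detour, h₁.minWalkWeight_eq hx, h₂.symm.minWalkWeight_eq hx]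

theorem reaches_detour [Finite V] (hx : G.Satisfies x) {e : V × V}
    (he : e ∈ G.interEdges v i j) : G.Reaches (v i) (v j) (G.detour v i j e) := by
  obtain ⟨h₁, h₂, h₃⟩ := mem_interEdges.1 he
  rw [detour_eq hx h₂ h₃]
  exact ((h₂.reaches hx).trans (.of_edge h₁)).trans (h₃.symm.reaches hx)

/-- An essential pair of classes is joined by an edge whose detour has minimum weight. -/
theorem IsEssential.exists_interEdge [Finite V] (hx : G.Satisfies x)
    (h : G.IsEssential (v i) (v j)) :
    ∃ e ∈ G.interEdges v i j, G.detour v i j e ≤ G.minWalkWeight (v i) (v j) := by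
  obtain ⟨a, b, hab, ha, hb, hc⟩ := h.exists_edge hx
  refine ⟨(a, b), mem_interEdges.2 ⟨hab, ha, hb⟩, ?_⟩
  rw [detour_eq hx ha hb]
  linarith

theorem mem_condensation_E :
    (i, j) ∈ (G.condensation v).E ↔ i ≠ j ∧ (G.interEdges v i j).Nonempty := by
  simp [condensation]

theorem condensation_c_le {e : V × V} (he : e ∈ G.interEdges v i j) :
    (G.condensation v).c i j ≤ G.detour v i j e :=
  csInf_le ((Finset.finite_toSet _).image _).bddBelow ⟨e, he, rfl⟩

theorem reaches_condensation_c [Finite V] (hx : G.Satisfies x)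
    (h : (i, j) ∈ (G.condensation v).E) :
    G.Reaches (v i) (v j) ((G.condensation v).c i j) := by
  have hne := (mem_condensation_E.1 h).2
  obtain ⟨e, he, heq⟩ := Set.Nonempty.csInf_mem
    (s := G.detour v i j '' (G.interEdges v i j : Set (V × V)))
    ((Finset.coe_nonempty.2 hne).image _) ((Finset.finite_toSet _).image _)
  have h := reaches_detour hx he
  rwa [heq] at h

open scoped Classical in
/-- The edges of the condensation that join inessential pairs of classes. -/
noncomputable def inessentialEdges (G : PrecGraph V) (v : Fin K → V) : Finset (Fin K × Fin K) :=
  (G.condensation v).E.filter fun p => ¬ G.IsEssential (v p.1) (v p.2)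

theorem mem_inessentialEdges :
    (i, j) ∈ G.inessentialEdges v ↔
      (i, j) ∈ (G.condensation v).E ∧ ¬ G.IsEssential (v i) (v j) := by
  simp [inessentialEdges]

theorem mem_deleteEdges_E {F : PrecGraph V} {R : Finset (V × V)} {e : V × V} :
    e ∈ (F.deleteEdges R).E ↔ e ∈ F.E ∧ e ∉ R := by
  simp [deleteEdges]

theorem reaches_of_reaches_deleteEdges [Finite V] (hx : G.Satisfies x)
    {R : Finset (Fin K × Fin K)} (h : ((G.condensation v).deleteEdges R).Reaches i j w) :
    G.Reaches (v i) (v j) w :=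
  h.map (F := (G.condensation v).deleteEdges R) v
    fun _ _ hab => reaches_condensation_c hx (mem_deleteEdges_E.1 hab).1

/-- Essential edges alone realize all distances between representatives: `reaches_induction`
decomposes any minimum weight walk into essential steps, and these edges are kept. -/
theorem isRedundantEdgeSet_inessentialEdges [Finite V] (hx : G.Satisfies x)
    (hv : G.IsRepresentatives v) :
    (G.condensation v).IsRedundantEdgeSet (G.inessentialEdges v) := by
  refine ⟨fun e he => (mem_inessentialEdges.1 he).1, fun i j hij => ?_⟩
  have hE := (mem_inessentialEdges.1 hij).1
  have hr := reaches_condensation_c hx hE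
  set F := (G.condensation v).deleteEdges (G.inessentialEdges v) with hF
  have key : F.Reaches i j (G.minWalkWeight (v i) (v j)) := by
    -- The induction runs over nodes of `V`; quantifying over the indices of their classes transfers
    -- it to the condensation.
    refine reaches_induction hx (Q := fun s t => ∀ i j, G.Sim (v i) s → G.Sim (v j) t →
      F.Reaches i j (G.minWalkWeight (v i) (v j))) ?_ ?_ ?_ hr i j (.refl G _) (.refl G _)
    · intro s t h i j hi hj
      obtain rfl := hv.eq_of_sim (hi.trans h hx) hj
      refine .refl _ _ ?_
      simp [(Sim.refl G (v i)).minWalkWeight_eq hx]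
    · intro s t h i j hi hj
      have h' := h.congr hx hi.symm hj.symm
      obtain ⟨e, he, hle⟩ := h'.exists_interEdge hx
      have hE : (i, j) ∈ (G.condensation v).E :=
        mem_condensation_E.2 ⟨fun hij => h'.1 (hij ▸ .refl G _), e, he⟩
      refine (Reaches.of_edge (G := F) (mem_deleteEdges_E.2
        ⟨hE, fun hc => (mem_inessentialEdges.1 hc).2 h'⟩)).mono ?_
      exact (condensation_c_le he).trans hle
    · intro s k t hsk hkt h h₁ h₂ i j hi hj
      obtain ⟨m, hm, -⟩ := hv k
      refine ((h₁ i m hi hm).trans (h₂ m j hm hj)).mono (le_of_eq ?_)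
      rw [minWalkWeight_congr hx hsk hi.symm hm.symm, minWalkWeight_congr hx hkt hm.symm hj.symm,
        minWalkWeight_congr hx (hsk.trans hkt) hi.symm hj.symm, ← h]
      ring
  have hFx : F.Satisfies (fun i => x (v i)) := fun i j hij =>
    (reaches_condensation_c hx (mem_deleteEdges_E.1 hij).1).sub_le hx
  obtain ⟨p, hp⟩ := key
  obtain ⟨q, hq, hle⟩ := p.exists_isPath hFx
  exact ⟨q, hq, (hle.trans hp).trans (hr.minWalkWeight_le hx)⟩

theorem IsRedundantEdgeSet.subset_inessentialEdges [Finite V] (hx : G.Satisfies x)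
    (hv : G.IsRepresentatives v) {R : Finset (Fin K × Fin K)}
    (hR : (G.condensation v).IsRedundantEdgeSet R) : R ⊆ G.inessentialEdges v := by
  rintro ⟨i, j⟩ hij
  refine mem_inessentialEdges.2 ⟨hR.1 hij, fun h => ?_⟩
  obtain ⟨p, hp, hw⟩ := hR.2 i j hij
  obtain ⟨e, he, hle⟩ := h.exists_interEdge hx
  have hne : i ≠ j := fun hij => h.1 (hij ▸ .refl G _)
  cases p with
  | nil => exact hne rfl
  | @cons _ k _ hk p =>
    have h₁ := mem_deleteEdges_E.1 hk
    have hkj : k ≠ j := by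
      -- If the first edge already ended at `j`, it would be the deleted edge `(i, j)`; so the walk
      -- visits a third class, against essentiality.
      rintro rfl
      exact h₁.2 hij
    have hik : i ≠ k := (mem_condensation_E.1 h₁.1).1
    simp only [Walk.weight] at hw
    rcases h.2.2 (v k) _ _ (reaches_of_reaches_deleteEdges hx (.of_edge hk))
      (reaches_of_reaches_deleteEdges hx ⟨p, le_rfl⟩)
      (hw.trans ((condensation_c_le he).trans hle)) with h₂ | h₂
    · exact hv.not_sim hik h₂
    · exact hv.not_sim hkj h₂

theorem IsMaximumRedundantEdgeSet.eq_inessentialEdges [Finite V] (hx : G.Satisfies x)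
    (hv : G.IsRepresentatives v) {R : Finset (Fin K × Fin K)}
    (hR : (G.condensation v).IsMaximumRedundantEdgeSet R) : R = G.inessentialEdges v :=
  Finset.eq_of_subset_of_card_le (hR.1.subset_inessentialEdges hx hv)
    (hR.2 _ (isRedundantEdgeSet_inessentialEdges hx hv))

theorem isEssential_iff_notMem [Finite V] (hx : G.Satisfies x) (hv : G.IsRepresentatives v)
    {R : Finset (Fin K × Fin K)} (hR : (G.condensation v).IsMaximumRedundantEdgeSet R)
    (hij : i ≠ j) :
    G.IsEssential (v i) (v j) ↔ (G.interEdges v i j).Nonempty ∧ (i, j) ∉ R := by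
  rw [hR.eq_inessentialEdges hx hv, mem_inessentialEdges, mem_condensation_E]
  constructor
  · intro h
    obtain ⟨e, he, -⟩ := h.exists_interEdge hx
    exact ⟨⟨e, he⟩, fun hc => hc.2 h⟩
  · rintro ⟨h₁, h₂⟩
    by_contra hc
    exact h₂ ⟨⟨hij, h₁⟩, hc⟩

/-- The weight imposed on an edge between the classes of an essential pair. -/
theorem IsRepresentingEdges.weight_eq [Finite V] (hx : G.Satisfies x)
    (hr : G.IsRepresentingEdges v r) (hij : i ≠ j) (h : G.IsEssential (v i) (v j)) {a b : V}
    (ha : G.Sim (v i) a) (hb : G.Sim (v j) b) :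
    G.minWalkWeight a (r i j).1 + G.c (r i j).1 (r i j).2 + G.minWalkWeight (r i j).2 b =
      G.minWalkWeight a b := by
  obtain ⟨e, he, hle⟩ := h.exists_interEdge hx
  obtain ⟨hr₁, hr₂⟩ := hr i j hij ⟨e, he⟩
  have h₁ := (reaches_detour hx hr₁).minWalkWeight_le hx
  have h₂ := hr₂ e he
  obtain ⟨-, h₃, h₄⟩ := mem_interEdges.1 hr₁
  rw [detour_eq hx h₃ h₄] at h₁ h₂
  rw [(ha.symm.trans h₃ hx).minWalkWeight_eq hx, (h₄.symm.trans hb hx).minWalkWeight_eq hx,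
    minWalkWeight_congr hx (h.reaches hx) ha hb]
  linarith

/-- The pairs of classes partition `V × V`, so minimizing the number of edges can be studied block
by block. -/
theorem card_eq_sum_edgesBetween (hv : G.IsRepresentatives v) (H : PrecGraph V) :
    H.E.card = ∑ p : Fin K × Fin K, (H.edgesBetween G.Sim (v p.1) (v p.2)).card := by
  classical
  choose f hf using fun u => (hv u).exists
  rw [Finset.card_eq_sum_card_fiberwise (f := fun e : V × V => (f e.1, f e.2))
    (t := Finset.univ) (fun _ _ => by simp)]
  refine Finset.sum_congr rfl fun p _ => congrArg Finset.card ?_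
  ext e
  rw [Finset.mem_filter, mem_edgesBetween, Prod.ext_iff]
  refine and_congr_right fun _ => and_congr ?_ ?_
  · exact ⟨fun h => h ▸ hf e.1, fun h => hv.eq_of_sim (hf e.1) h⟩
  · exact ⟨fun h => h ▸ hf e.2, fun h => hv.eq_of_sim (hf e.2) h⟩

/-! ### Lower bounds on the blocks and their attainment. -/

section Counting

variable [Fintype V]

open scoped Classical in
/-- The number of edges from the class of `v i` to the class of `v j` in an equivalent reduction. -/
noncomputable def blockCard (G : PrecGraph V) (v : Fin K → V) (i j : Fin K) : ℕ :=
  if i = j then (if (G.cls (v i)).card = 1 then 0 else (G.cls (v i)).card)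
  else if G.IsEssential (v i) (v j) then 1 else 0

/-- In a graph equivalent to `G`, each node of a class with several nodes has a tight edge to
another node of the class. -/
theorem Equivalent.exists_successor (hx : G.Satisfies x) (h : G.Equivalent H) {a : V}
    (hc : (G.cls a).card ≠ 1) :
    ∃ n : V → V, ∀ u, G.Sim a u → (u, n u) ∈ H.edgesBetween G.Sim a a ∧ n u ≠ u ∧
      H.c u (n u) = x u - x (n u) := by
  have : ∀ u, ∃ b, G.Sim a u → (u, b) ∈ H.edgesBetween G.Sim a a ∧ b ≠ u ∧
      H.c u b = x u - x b := by
    intro u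
    by_cases hu : G.Sim a u
    · obtain ⟨u', hu', hne⟩ := exists_sim_ne_of_card_cls_ne_one hc u
      obtain ⟨b, h₁, h₂, h₃, h₄⟩ := exists_tight_edge ((h x).1 hx)
        ((h.sim_iff hx).2 (hu.symm.trans hu' hx)) hne.symm
      exact ⟨b, fun _ => ⟨mem_edgesBetween.2
        ⟨h₁, hu, hu.trans ((h.sim_iff hx).1 h₃) hx⟩, h₂, h₄⟩⟩
    · exact ⟨u, fun h => absurd h hu⟩
  choose n hn using this
  exact ⟨n, hn⟩

theorem Equivalent.exists_edge_of_isEssential (hx : G.Satisfies x) (h : G.Equivalent H)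
    (hs : G.IsEssential s t) : ∃ a b, (a, b) ∈ H.edgesBetween G.Sim s t ∧
      H.c a b = G.minWalkWeight a b := by
  have hx' := (h x).1 hx
  obtain ⟨a, b, hab, ha, hb, hc⟩ := ((h.isEssential_iff hx).2 hs).exists_edge hx'
  rw [h.sim_iff hx] at ha hb
  rw [h.minWalkWeight_eq hx] at hc
  refine ⟨a, b, mem_edgesBetween.2 ⟨hab, ha, hb⟩, ?_⟩
  have h₁ := (Reaches.of_edge hab).minWalkWeight_le hx'
  rw [h.minWalkWeight_eq hx] at h₁
  have h₂ := minWalkWeight_congr hx (hs.reaches hx) ha hb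
  linarith

/-- Inside a class the edges `(u, n u)` are distinct because their tails are; an essential pair
forces one edge. -/
theorem Equivalent.blockCard_le (hx : G.Satisfies x) (h : G.Equivalent H) (i j : Fin K) :
    G.blockCard v i j ≤ (H.edgesBetween G.Sim (v i) (v j)).card := by
  unfold blockCard
  split_ifs with h₁ h₂ h₂
  · exact Nat.zero_le _
  · subst h₁
    obtain ⟨n, hn⟩ := h.exists_successor hx h₂
    exact Finset.card_le_card_of_injOn (fun u => (u, n u)) (fun u hu => (hn u (mem_cls.1 hu)).1)
      fun u _ u' _ huu => (Prod.ext_iff.1 huu).1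
  · obtain ⟨a, b, hab, -⟩ := h.exists_edge_of_isEssential hx h₂
    exact Finset.card_pos.2 ⟨_, hab⟩
  · exact Nat.zero_le _

/-- An equivalent graph in which all lower bounds on the numbers of edges are attained. -/
theorem exists_equivalent_card_le (hx : G.Satisfies x) (hv : G.IsRepresentatives v) :
    ∃ H : PrecGraph V, G.Equivalent H ∧
      ∀ i j, (H.edgesBetween G.Sim (v i) (v j)).card ≤ G.blockCard v i j := by
  classical
  choose f hf using fun u => (hv u).exists
  -- A cyclic permutation of each class supplies the cycle edges `E₁`; one edge between
  -- representatives for each essential pair gives `E₂`.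
  choose σ hσ _ using fun k => Finset.exists_cycleOn (G.cls (v k))
  have hmaps : ∀ k u, G.Sim (v k) u → G.Sim (v k) (σ k u) := fun k u hu =>
    mem_cls.1 ((hσ k).1.mapsTo (mem_cls.2 hu))
  let next : V → V := fun u => σ (f u) u
  have hf_eq : ∀ {k u}, G.Sim (v k) u → f u = k := fun h => hv.eq_of_sim (hf _) h
  have hnext : ∀ u, G.Sim u (next u) := fun u => (hf u).symm.trans (hmaps _ _ (hf u)) hx
  let E₁ : Finset (V × V) :=
    (Finset.univ.filter fun u => (G.cls (v (f u))).card ≠ 1).image fun u => (u, next u)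
  let E₂ : Finset (V × V) :=
    (Finset.univ.filter fun p : Fin K × Fin K => G.IsEssential (v p.1) (v p.2)).image
      fun p => (v p.1, v p.2)
  let H : PrecGraph V := ⟨E₁ ∪ E₂, G.minWalkWeight⟩
  have hE : ∀ e, e ∈ H.E ↔ ((G.cls (v (f e.1))).card ≠ 1 ∧ e.2 = next e.1) ∨
      ∃ i j, G.IsEssential (v i) (v j) ∧ e = (v i, v j) := by
    rintro ⟨a, b⟩
    simp only [H, E₁, E₂, Finset.mem_union, Finset.mem_image, Finset.mem_filter, Finset.mem_univ,
      true_and, Prod.exists, Prod.mk.injEq]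
    refine or_congr ⟨?_, ?_⟩ ⟨?_, ?_⟩
    · rintro ⟨u, h₁, rfl, rfl⟩
      exact ⟨h₁, rfl⟩
    · rintro ⟨h₁, rfl⟩
      exact ⟨a, h₁, rfl, rfl⟩
    · rintro ⟨i, j, h₁, rfl, rfl⟩
      exact ⟨i, j, h₁, rfl, rfl⟩
    · rintro ⟨i, j, h₁, rfl, rfl⟩
      exact ⟨i, j, h₁, rfl, rfl⟩
  refine ⟨H, equivalent_of_tight hx ?_ ?_ ?_, fun i j => ?_⟩
  · intro a b hab
    rcases (hE _).1 hab with ⟨-, rfl : b = next a⟩ | ⟨i, j, h, heq⟩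
    · exact ((hnext a).reaches hx).minWalkWeight hx
    · obtain ⟨rfl, rfl⟩ := Prod.mk.inj heq
      exact h.reaches hx
  · intro s t hst
    have ht : G.Sim (v (f s)) t := (hf s).trans hst hx
    by_cases hc : (G.cls (v (f s))).card = 1
    · obtain rfl := eq_of_sim_of_card_cls_eq_one hc (hf s) ht
      exact .refl _ _ (by simp)
    · obtain ⟨n, -, hn⟩ := (hσ (f s)).exists_pow_eq (mem_cls.2 (hf s)) (mem_cls.2 ht)
      have key : ∀ n : ℕ, G.Sim s ((σ (f s) ^ n) s) ∧
          H.Reaches s ((σ (f s) ^ n) s) (x s - x ((σ (f s) ^ n) s)) := by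
        intro n
        induction n with
        | zero => exact ⟨.refl G s, .refl _ _ (by simp)⟩
        | succ n ih =>
          obtain ⟨h₁, h₂⟩ := ih
          rw [pow_succ', Equiv.Perm.mul_apply]
          set y := (σ (f s) ^ n) s with hy
          have hfy : f y = f s := hf_eq ((hf s).trans h₁ hx)
          have hny : σ (f s) y = next y := by simp only [next, hfy]
          rw [hny]
          have hed : (y, next y) ∈ H.E := (hE _).2 (Or.inl ⟨by rwa [hfy], rfl⟩)
          have hw : H.c y (next y) = x y - x (next y) := (hnext y).minWalkWeight_eq hx
          exact ⟨h₁.trans (hnext y) hx,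
            (h₂.trans (.of_edge hed)).mono (by rw [hw]; linarith)⟩
      have := (key n).2
      rwa [hn] at this
  · intro s t h
    have h₁ := h.congr hx (hf s).symm (hf t).symm
    refine ⟨v (f s), v (f t), (hE _).2 (Or.inr ⟨_, _, h₁, rfl⟩), (hf s).symm, (hf t).symm, ?_⟩
    have := minWalkWeight_congr hx (h.reaches hx) (hf s).symm (hf t).symm
    exact this.le
  · have hmem : ∀ e ∈ H.edgesBetween G.Sim (v i) (v j),
        (i = j ∧ (G.cls (v i)).card ≠ 1 ∧ G.Sim (v i) e.1 ∧ e = (e.1, next e.1)) ∨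
        (i ≠ j ∧ G.IsEssential (v i) (v j) ∧ e = (v i, v j)) := by
      rintro ⟨a, b⟩ he
      obtain ⟨h₁, h₂ : G.Sim (v i) a, h₃ : G.Sim (v j) b⟩ := mem_edgesBetween.1 he
      rcases (hE _).1 h₁ with ⟨h₄, rfl : b = next a⟩ | ⟨i', j', h, heq⟩
      · rw [hf_eq h₂] at h₄
        exact Or.inl ⟨hv.eq_of_sim (h₂.trans (hnext a) hx) h₃, h₄, h₂, rfl⟩
      · obtain ⟨rfl, rfl⟩ := Prod.mk.inj heq
        obtain rfl := hv.eq_of_sim h₂ (.refl G _)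
        obtain rfl := hv.eq_of_sim h₃ (.refl G _)
        exact Or.inr ⟨fun hij => h.1 (hij ▸ .refl G _), h, rfl⟩
    unfold blockCard
    split_ifs with h₁ h₂ h₂
    · rw [Nat.le_zero, Finset.card_eq_zero]
      refine Finset.eq_empty_of_forall_notMem fun e he => ?_
      rcases hmem e he with ⟨-, h₃, -⟩ | ⟨h₃, -⟩
      · exact h₃ h₂
      · exact h₃ h₁
    · refine (Finset.card_le_card (t := (G.cls (v i)).image fun u => (u, next u)) ?_).trans
        Finset.card_image_le
      intro e he
      rcases hmem e he with ⟨-, -, h₃, h₄⟩ | ⟨h₃, -⟩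
      · exact Finset.mem_image.2 ⟨e.1, mem_cls.2 h₃, h₄.symm⟩
      · exact absurd h₁ h₃
    · refine Finset.card_le_one.2 fun e he e' he' => ?_
      rcases hmem e he with ⟨h₃, -⟩ | ⟨-, -, h₃⟩
      · exact absurd h₃ h₁
      rcases hmem e' he' with ⟨h₄, -⟩ | ⟨-, -, h₄⟩
      · exact absurd h₄ h₁
      rw [h₃, h₄]
    · rw [Nat.le_zero, Finset.card_eq_zero]
      refine Finset.eq_empty_of_forall_notMem fun e he => ?_
      rcases hmem e he with ⟨h₃, -⟩ | ⟨-, h₃, -⟩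
      · exact h₁ h₃
      · exact h₂ h₃

/-- The equivalent reductions are the equivalent graphs with the prescribed number of edges between
any two classes. -/
theorem isEquivalentReduction_iff_card (hx : G.Satisfies x) (hv : G.IsRepresentatives v)
    (H : PrecGraph V) : G.IsEquivalentReduction H ↔ G.Equivalent H ∧
      ∀ i j, (H.edgesBetween G.Sim (v i) (v j)).card = G.blockCard v i j := by
  refine and_congr_right fun h => ⟨fun hmin i j => ?_, fun hcard H₂ h₂ => ?_⟩
  · obtain ⟨H₀, h₀, hle⟩ := exists_equivalent_card_le hx hv
    have h₁ := hmin H₀ h₀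
    rw [card_eq_sum_edgesBetween hv H, card_eq_sum_edgesBetween hv H₀] at h₁
    have h₂ : ∀ p ∈ (Finset.univ : Finset (Fin K × Fin K)), G.blockCard v p.1 p.2 ≤
        (H.edgesBetween G.Sim (v p.1) (v p.2)).card := fun p _ => h.blockCard_le hx _ _
    have h₃ := Finset.sum_le_sum h₂
    have h₄ := Finset.sum_le_sum fun (p : Fin K × Fin K) (_ : p ∈ Finset.univ) => hle p.1 p.2
    -- The termwise lower bounds and the witness `H₀` squeeze the total, so each block attains its
    -- own bound.
    exact ((Finset.sum_eq_sum_iff_of_le h₂).1 (le_antisymm h₃ (h₁.trans h₄)) (i, j)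
      (Finset.mem_univ _)).symm
  · rw [card_eq_sum_edgesBetween hv H, card_eq_sum_edgesBetween hv H₂]
    exact Finset.sum_le_sum fun p _ => (hcard _ _).trans_le (h₂.blockCard_le hx _ _)

/-- If an equivalent graph has as many edges inside a class with several nodes as there are nodes,
then these edges are tight and form a cycle. -/
theorem Equivalent.formsZeroWeightCycle (hx : G.Satisfies x) (h : G.Equivalent H) {a : V}
    (hc : (G.cls a).card ≠ 1)
    (hcard : (H.edgesBetween G.Sim a a).card = (G.cls a).card) :
    (∀ e ∈ H.edgesBetween G.Sim a a, H.c e.1 e.2 = x e.1 - x e.2) ∧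
      H.FormsZeroWeightCycle (H.edgesBetween G.Sim a a) (G.cls a) := by
  classical
  have hx' := (h x).1 hx
  obtain ⟨n, hn⟩ := h.exists_successor hx hc
  -- The edges `(u, n u)` already number as many as the block contains, so they are the whole block
  -- and each node has a single outgoing edge in it.
  have himg : (G.cls a).image (fun u => (u, n u)) = H.edgesBetween G.Sim a a := by
    refine Finset.eq_of_subset_of_card_le ?_ ?_
    · intro e he
      obtain ⟨u, hu, rfl⟩ := Finset.mem_image.1 he
      exact (hn u (mem_cls.1 hu)).1
    · rw [hcard, Finset.card_image_of_injective _ fun u u' huu => (Prod.ext_iff.1 huu).1]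
  have hedge : ∀ e ∈ H.edgesBetween G.Sim a a, e.2 = n e.1 := by
    intro e he
    rw [← himg] at he
    obtain ⟨u, -, rfl⟩ := Finset.mem_image.1 he
    rfl
  refine ⟨fun e he => ?_, ?_⟩
  · rw [hedge e he]
    exact (hn e.1 (mem_edgesBetween.1 he).2.1).2.2
  have hsim : ∀ {y z}, H.Sim y z ↔ G.Sim y z := h.sim_iff hx
  obtain ⟨ha₁, -, ha₂⟩ := hn a (.refl G a)
  obtain ⟨ha₃, -, ha₄⟩ := mem_edgesBetween.1 ha₁
  have hback : H.Sim (n a) a := hsim.2 ha₄.symm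
  -- The cycle is the edge from `a` to `n a`, closed by a tight path back to `a`; tightness keeps
  -- this path inside the class.
  obtain ⟨q, hq⟩ := hback.reaches hx'
  obtain ⟨p, hp, hpq⟩ := q.exists_isPath hx'
  have hpw := hpq.trans hq
  have hsupp : ∀ z ∈ p.support, G.Sim a z := fun z hz =>
    ha₄.trans (hsim.1 (sim_of_mem_support hx' hback p hpw hz)) hx
  have hedges : ∀ e ∈ (Walk.cons ha₃ p).edges, e ∈ H.edgesBetween G.Sim a a := by
    intro e he
    simp only [Walk.edges, List.mem_cons] at he
    rcases he with rfl | he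
    · exact ha₁
    · obtain ⟨h₁, h₂, h₃⟩ := p.mem_edges he
      exact mem_edgesBetween.2 ⟨h₁, hsupp _ h₂, hsupp _ h₃⟩
  have hsucc : ∀ z ∈ p.support, (z, n z) ∈ (Walk.cons ha₃ p).edges := by
    intro z hz
    rcases p.exists_edge_of_mem_support hz with rfl | ⟨y, hy⟩
    · simp [Walk.edges]
    · have h₁ : (z, y) ∈ (Walk.cons ha₃ p).edges := by simp [Walk.edges, hy]
      rwa [← show y = n z from hedge _ (hedges _ h₁)]
  have hnext : ∀ z ∈ p.support, n z ∈ p.support := by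
    intro z hz
    have h₁ := hsucc z hz
    simp only [Walk.edges, List.mem_cons] at h₁
    rcases h₁ with h₁ | h₁
    · rw [show n z = n a from (Prod.ext_iff.1 h₁).2]
      exact p.start_mem_support
    · exact (p.mem_edges h₁).2.2
  -- A tight walk from `a` to any node of the class stays in the class, so each of its steps is `n`;
  -- the support of `p` contains `a` and is closed under `n`.
  have hall : ∀ z, G.Sim a z → z ∈ p.support := by
    intro z hz
    obtain ⟨m, hm⟩ := (hsim.2 hz).reaches hx'
    have hm' : ∀ y ∈ m.support, G.Sim a y := fun y hy =>
      hsim.1 (sim_of_mem_support hx' (hsim.2 hz) m hm hy)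
    have hstart := p.end_mem_support
    clear hm
    suffices H' : ∀ (b z : V) (m : H.Walk b z), (∀ y ∈ m.support, G.Sim a y) →
        b ∈ p.support → z ∈ p.support from H' a z m hm' hstart
    intro b z m
    induction m with
    | nil u => exact fun _ h => h
    | @cons b y z hby m ih =>
      intro hm hb
      have h₁ : (b, y) ∈ H.edgesBetween G.Sim a a := mem_edgesBetween.2
        ⟨hby, hm b (by simp [Walk.support]), hm y (by simp [Walk.support, m.start_mem_support])⟩
      refine ih (fun y hy => hm y (by simp [Walk.support, hy])) ?_
      rw [show y = n b from hedge _ h₁]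
      exact hnext b hb
  refine ⟨a, .cons ha₃ p, ⟨by simp [Walk.edges], hp⟩, ?_, fun z => ?_, fun e => ⟨hedges e, ?_⟩⟩
  · have h₁ := p.sub_le_weight hx'
    simp only [Walk.weight]
    linarith
  · rw [mem_cls]
    refine ⟨fun hz => ?_, fun hz => ?_⟩
    · simp only [Walk.support, List.mem_cons] at hz
      rcases hz with rfl | hz
      · exact .refl G _
      · exact hsupp z hz
    · simp [Walk.support, hall z hz]
  · intro he
    have h₁ := hsucc e.1 (hall _ (mem_edgesBetween.1 he).2.1)
    rwa [← hedge e he] at h₁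

end Counting

end Condensation

end PrecGraph

/-! ### The characterization of equivalent reductions. -/

open PrecGraph

theorem mainTheorem4 {V : Type*} [Fintype V] (G : PrecGraph V) (hG : G.Feasible)
    {K : ℕ} (v : Fin K → V) (hv : G.IsRepresentatives v)
    (r : Fin K → Fin K → V × V) (hr : G.IsRepresentingEdges v r)
    (R₀ : Finset (Fin K × Fin K)) (hR₀ : (G.condensation v).IsMaximumRedundantEdgeSet R₀)
    (G' : PrecGraph V) :
    G.IsEquivalentReduction G' ↔
      -- edges inside the classes
      (∀ k : Fin K,
        ((G.cls (v k)).card = 1 → G'.edgesBetween G.Sim (v k) (v k) = ∅) ∧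
        ((G.cls (v k)).card ≠ 1 →
          (G'.edgesBetween G.Sim (v k) (v k)).card = (G.cls (v k)).card ∧
          G'.FormsZeroWeightCycle (G'.edgesBetween G.Sim (v k) (v k)) (G.cls (v k)))) ∧
      -- edges between different classes
      (∀ i j : Fin K, i ≠ j →
        ((G.interEdges v i j).Nonempty ∧ (i, j) ∉ R₀ →
          ∃ a b : V, G'.edgesBetween G.Sim (v i) (v j) = {(a, b)}) ∧
        (¬ (G.interEdges v i j).Nonempty ∨ (i, j) ∈ R₀ →
          G'.edgesBetween G.Sim (v i) (v j) = ∅)) ∧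
      -- weights of the edges inside the classes
      (∀ (k : Fin K) (a b : V), (a, b) ∈ G'.edgesBetween G.Sim (v k) (v k) →
        G'.c a b = G.minWalkWeight a b) ∧
      -- weights of the edges between different classes
      (∀ i j : Fin K, i ≠ j → ∀ a b : V, (a, b) ∈ G'.edgesBetween G.Sim (v i) (v j) →
        G'.c a b = G.minWalkWeight a (r i j).1 + G.c (r i j).1 (r i j).2
          + G.minWalkWeight (r i j).2 b) := by
  obtain ⟨x, hx⟩ := hG
  have hess : ∀ {i j : Fin K}, i ≠ j → (G.IsEssential (v i) (v j) ↔
      (G.interEdges v i j).Nonempty ∧ (i, j) ∉ R₀) := fun h =>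
    isEssential_iff_notMem hx hv hR₀ h
  rw [isEquivalentReduction_iff_card hx hv]
  constructor
  · rintro ⟨h, hcard⟩
    refine ⟨fun k => ⟨fun hk => ?_, fun hk => ?_⟩, fun i j hij => ⟨fun h₁ => ?_, fun h₁ => ?_⟩,
      fun k a b hab => ?_, fun i j hij a b hab => ?_⟩
    · rw [← Finset.card_eq_zero, hcard]
      simp [blockCard, hk]
    · have h₁ : (G'.edgesBetween G.Sim (v k) (v k)).card = (G.cls (v k)).card := by
        rw [hcard]
        simp [blockCard, hk]
      exact ⟨h₁, (h.formsZeroWeightCycle hx hk h₁).2⟩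
    · have h₂ : (G'.edgesBetween G.Sim (v i) (v j)).card = 1 := by
        rw [hcard]
        simp [blockCard, hij, (hess hij).2 h₁]
      obtain ⟨⟨a, b⟩, hab⟩ := Finset.card_eq_one.1 h₂
      exact ⟨a, b, hab⟩
    · have h₂ : ¬ G.IsEssential (v i) (v j) := fun h₂ => by
        obtain ⟨h₃, h₄⟩ := (hess hij).1 h₂
        exact h₁.elim (fun h => h h₃) h₄
      rw [← Finset.card_eq_zero, hcard]
      simp [blockCard, hij, h₂]
    · have hk : (G.cls (v k)).card ≠ 1 := by
        intro hk
        have h₁ : (G'.edgesBetween G.Sim (v k) (v k)).card = 0 := by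
          rw [hcard]
          simp [blockCard, hk]
        rw [Finset.card_eq_zero] at h₁
        simp [h₁] at hab
      have h₁ : (G'.edgesBetween G.Sim (v k) (v k)).card = (G.cls (v k)).card := by
        rw [hcard]
        simp [blockCard, hk]
      obtain ⟨-, ha, hb⟩ := mem_edgesBetween.1 hab
      rw [(ha.symm.trans hb hx).minWalkWeight_eq hx]
      exact (h.formsZeroWeightCycle hx hk h₁).1 _ hab
    · have h₁ : G.IsEssential (v i) (v j) := by
        by_contra h₁
        have h₂ : (G'.edgesBetween G.Sim (v i) (v j)).card = 0 := by
          rw [hcard]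
          simp [blockCard, hij, h₁]
        rw [Finset.card_eq_zero] at h₂
        simp [h₂] at hab
      have h₂ : (G'.edgesBetween G.Sim (v i) (v j)).card ≤ 1 := by
        rw [hcard]
        simp [blockCard, hij, h₁]
      -- Equivalence forces some edge of this block to have weight equal to the distance, and the
      -- block has only one edge.
      obtain ⟨a', b', hab', hc⟩ := h.exists_edge_of_isEssential hx h₁
      obtain ⟨rfl, rfl⟩ := Prod.mk.inj (Finset.card_le_one.1 h₂ _ hab _ hab')
      obtain ⟨-, ha, hb⟩ := mem_edgesBetween.1 hab
      rw [hr.weight_eq hx hij h₁ ha hb]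
      exact hc
  · rintro ⟨h₁, h₂, h₃, h₄⟩
    have hinter : ∀ {i j : Fin K}, i ≠ j → ¬ G.IsEssential (v i) (v j) →
        G'.edgesBetween G.Sim (v i) (v j) = ∅ := fun hij h => by
      rw [hess hij, not_and_or, not_not] at h
      exact (h₂ _ _ hij).2 h
    have hweight : ∀ {i j : Fin K} {a b : V}, (a, b) ∈ G'.E → G.Sim (v i) a → G.Sim (v j) b →
        (i = j ∨ G.IsEssential (v i) (v j)) ∧ G'.c a b = G.minWalkWeight a b := by
      intro i j a b hab ha hb
      have hmem : (a, b) ∈ G'.edgesBetween G.Sim (v i) (v j) := mem_edgesBetween.2 ⟨hab, ha, hb⟩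
      by_cases hij : i = j
      · subst hij
        exact ⟨Or.inl rfl, h₃ _ _ _ hmem⟩
      · have he : G.IsEssential (v i) (v j) := by
          by_contra he
          simp [hinter hij he] at hmem
        exact ⟨Or.inr he, by rw [h₄ i j hij a b hmem, hr.weight_eq hx hij he ha hb]⟩
    have sound : ∀ a b, (a, b) ∈ G'.E → G.Reaches a b (G'.c a b) := by
      intro a b hab
      obtain ⟨i, hi, -⟩ := hv a
      obtain ⟨j, hj, -⟩ := hv b
      obtain ⟨h₅ | h₅, h₆⟩ := hweight hab hi hj
      · subst h₅
        rw [h₆]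
        exact ((hi.symm.trans hj hx).reaches hx).minWalkWeight hx
      · rw [h₆]
        exact (h₅.congr hx hi hj).reaches hx
    have hx' : G'.Satisfies x := fun a b hab => (sound a b hab).sub_le hx
    refine ⟨equivalent_of_tight hx sound ?_ ?_, fun i j => ?_⟩
    · intro s t hst
      obtain ⟨k, hk, -⟩ := hv s
      have hkt := hk.trans hst hx
      by_cases hc : (G.cls (v k)).card = 1
      · obtain rfl := eq_of_sim_of_card_cls_eq_one hc hk hkt
        exact .refl _ _ (by simp)
      · obtain ⟨-, u, p, -, hp, hsupp, -⟩ := (h₁ k).2 hc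
        -- The zero-weight cycle makes `s` and `t` equivalent in `G'` itself. As `x` also solves
        -- `G'`, they are joined there by a tight walk.
        have hsim : G'.Sim s t :=
          Or.inr ⟨u, p, hp, (hsupp s).2 (mem_cls.2 hk), (hsupp t).2 (mem_cls.2 hkt)⟩
        exact hsim.reaches hx'
    · intro s t hst
      obtain ⟨i, hi, -⟩ := hv s
      obtain ⟨j, hj, -⟩ := hv t
      have he := hst.congr hx hi.symm hj.symm
      have hij : i ≠ j := fun hij => he.1 (hij ▸ .refl G _)
      obtain ⟨a, b, hab⟩ := (h₂ i j hij).1 ((hess hij).1 he)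
      have hmem : (a, b) ∈ G'.edgesBetween G.Sim (v i) (v j) := by simp [hab]
      obtain ⟨hE, ha, hb⟩ := mem_edgesBetween.1 hmem
      have hsa := hi.symm.trans ha hx
      have htb := hj.symm.trans hb hx
      refine ⟨a, b, hE, hsa, htb, ?_⟩
      rw [(hweight hE ha hb).2, minWalkWeight_congr hx (hst.reaches hx) hsa htb]
    · unfold blockCard
      split_ifs with h₅ h₆ h₆
      · subst h₅
        rw [(h₁ i).1 h₆, Finset.card_empty]
      · subst h₅
        exact ((h₁ i).2 h₆).1
      · obtain ⟨a, b, hab⟩ := (h₂ i j h₅).1 ((hess h₅).1 h₆)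
        rw [hab, Finset.card_singleton]
      · rw [hinter h₅ h₆, Finset.card_empty]
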